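/- Let $\mathcal A$ be a unital algebra over $\mathbb C$, $\mathcal B\subset\mathcal A$ a unital subalgebra, and $E:\mathcal A\to\mathcal B$ a conditional expectation, i.e. a linear map with $E[b]=b$ and $E[b_1ab_2]=b_1E[a]b_2$ for $b,b_1,b_2\in\mathcal B$, $a\in\mathcal A$. A multilinear function series is a sequence $F=(F_n)_{n\ge 0}$ of $n$-linear maps $F_n:\mathcal B^{n}\to\mathcal B$ (with $F_0\in\mathcal B$ a constant). Sums are termwise, products are $$(F\cdot G)_n(b_1,\dots,b_n)=\sum_{k=0}^nF_k(b_1,\dots,b_k)\,G_{n-k}(b_{k+1},\dots,b_n),$$ and, if $G_0=0$, the composition is given by $(F\circ G)_0=F_0$ and, for $n\ge1$, $$(F\circ G)_n(b_1,\dots,b_n)=\sum_{k=1}^n\ \sum_{\substack{p_1,\dots,p_k\ge1\\ p_1+\cdots+p_k=n}}F_k\bigl(G_{p_1}(b_1,\dots,b_{p_1}),\dots,G_{p_k}(b_{n-p_k+1},\dots,b_n)\bigr).$$ Composition binds stronger than product. Let $1$ be the series whose only non-zero term is the constant term $1\in\mathcal B$, and $I$ the series with $I_1(b)=b$ and $I_n=0$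 for $n\ne1$. For $x\in\mathcal A$ let $\Phi_x$ be the moment series, $(\Phi_x)_n(b_1,\dots,b_n)=E[xb_1xb_2x\cdots b_nx]$. If $E[x]$ is invertible in $\mathcal B$, the $S$-transform $S_x$ is the series defined by $(1+I)\cdot\chi_x=I\cdot S_x$, where $\chi_x$ is the series with zero constant term such that $(I\cdot\Phi_x)\circ\chi_x=I$. Elements $x,y\in\mathcal A$ are free with amalgamation over $\mathcal B$ if, with $\mathcal A_1$ and $\mathcal A_2$ the subalgebras generated by $\mathcal B\cup\{x\}$ and by $\mathcal B\cup\{y\}$, one has $E[a_1\cdots a_n]=0$ whenever $n\ge1$, $a_j\in\mathcal A_{i_j}$, $E[a_j]=0$ for all $j$, and $i_1\ne i_2\ne\cdots\ne i_n$. **Theorem (Dykema).** Let $x,y\in\mathcal A$ be free with amalgamation over $\mathcal B$, and assume that $E[x]$ and $E[y]$ are invertible in $\mathcal B$. Then $E[xy]=E[x]E[y]$ is invertible in $\mathcal B$, the series $S_x$, $S_y$ and $S_{xy}$ exist and are uniquely determined, $S_y$ has a multiplicative inverse $S_y^{-1}$, and $$S_{xy}=S_y\cdot S_x\circ(S_y^{-1}\cdot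 I\cdot S_y).$$ -/

import Mathlib

/-- A multilinear function series over a complex unital algebra `B`: a sequence `F = (F_n)_{n ≥ 0}`
of `n`-linear maps `F_n : B × ⋯ × B → B`; the `0`-linear map `F_0` is a constant in `B`. -/
def MulSeries (B : Type*) [Ring B] [Algebra ℂ B] : Type _ :=
  (n : ℕ) → MultilinearMap ℂ (fun _ : Fin n => B) B

namespace MulSeries

/-- Changing one entry of `(b_1, …, b_n)` changes one entry of exactly one of the two pieces
`(b_1, …, b_k)` and `(b_{k+1}, …, b_n)`. -/
theorem split_update {B : Type*} {n : ℕ} (k : Fin (n + 1)) (b : Fin n → B) (j : Fin n) :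
    (∃ j' : Fin k, ∀ z : B,
      (fun i : Fin k => Function.update b j z ⟨i, by omega⟩) =
        Function.update (fun i : Fin k => b ⟨i, by omega⟩) j' z ∧
      (fun i : Fin (n - k) => Function.update b j z ⟨k + i, by omega⟩) =
        fun i : Fin (n - k) => b ⟨k + i, by omega⟩) ∨
    (∃ j' : Fin (n - k), ∀ z : B,
      (fun i : Fin k => Function.update b j z ⟨i, by omega⟩) =
        (fun i : Fin k => b ⟨i, by omega⟩) ∧
      (fun i : Fin (n - k) => Function.update b j z ⟨k + i, by omega⟩) =
        Function.update (fun i : Fin (n - k) => b ⟨k + i, by omega⟩) j' z) := by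
  by_cases h : (j : ℕ) < k
  · refine Or.inl ⟨⟨j, h⟩, fun z => ⟨?_, ?_⟩⟩ <;>
      (funext i; simp only [Function.update_apply, Fin.ext_iff] <;> grind)
  · refine Or.inr ⟨⟨j - k, by omega⟩, fun z => ⟨?_, ?_⟩⟩ <;>
      (funext i; simp only [Function.update_apply, Fin.ext_iff]; grind)

section

variable {B : Type*} [Ring B] [Algebra ℂ B]

/-- Addition of series is termwise. -/
instance : AddCommGroup (MulSeries B) :=
  inferInstanceAs (AddCommGroup ((n : ℕ) → MultilinearMap ℂ (fun _ : Fin n => B) B))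

/-- The series `1`: constant term `1 ∈ B`, all other terms `0`. -/
instance : One (MulSeries B) :=
  ⟨fun n => match n with
    | 0 => MultilinearMap.constOfIsEmpty ℂ _ 1
    | _ + 1 => 0⟩

/-- The series `I`: linear term `b ↦ b`, all other terms `0`. -/
def I : MulSeries B := fun n => match n with
  | 1 => MultilinearMap.ofSubsingleton ℂ B B (0 : Fin 1) LinearMap.id
  | _ => 0

/-- The multilinear map `(b_1, …, b_n) ↦ F_k(b_1, …, b_k) G_{n-k}(b_{k+1}, …, b_n)`. -/
def mulTerm (F G : MulSeries B) (n : ℕ) (k : Fin (n + 1)) :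
    MultilinearMap ℂ (fun _ : Fin n => B) B :=
  MultilinearMap.mk'
    (fun b => F k (fun i => b ⟨i, by omega⟩) * G (n - k) (fun i => b ⟨k + i, by omega⟩))
    (by
      intro b j u v
      rcases split_update k b j with ⟨j', h⟩ | ⟨j', h⟩
      · simp only [(h _).1, (h _).2, MultilinearMap.map_update_add, add_mul]
      · simp only [(h _).1, (h _).2, MultilinearMap.map_update_add, mul_add])
    (by
      intro b j c v
      rcases split_update k b j with ⟨j', h⟩ | ⟨j', h⟩
      · simp only [(h _).1, (h _).2, MultilinearMap.map_update_smul, smul_mul_assoc]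
      · simp only [(h _).1, (h _).2, MultilinearMap.map_update_smul, mul_smul_comm])

/-- The product of series:
`(F · G)_n(b_1, …, b_n) = ∑_{k=0}^n F_k(b_1, …, b_k) G_{n-k}(b_{k+1}, …, b_n)`. -/
instance : Mul (MulSeries B) := ⟨fun F G n => ∑ k : Fin (n + 1), mulTerm F G n k⟩

theorem mul_apply (F G : MulSeries B) (n : ℕ) (b : Fin n → B) :
    (F * G) n b = ∑ k : Fin (n + 1),
      F k (fun i => b ⟨i, by omega⟩) * G (n - k) (fun i => b ⟨k + i, by omega⟩) := by
  change (∑ k : Fin (n + 1), mulTerm F G n k) b = _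
  rw [sum_apply]
  rfl

/-- For a composition `c = (p_1, …, p_k)` of `n`, the tuple
`(G_{p_1}(b_1, …, b_{p_1}), G_{p_2}(b_{p_1+1}, …, b_{p_1+p_2}), …, G_{p_k}(…, b_n))`. -/
def blockApply (G : MulSeries B) {n : ℕ} (c : Composition n) (b : Fin n → B) :
    Fin c.length → B :=
  fun i => G (c.blocksFun i) (b ∘ c.embedding i)

theorem blockApply_update (G : MulSeries B) {n : ℕ} (c : Composition n) (j : Fin n)
    (b : Fin n → B) (z : B) :
    G.blockApply c (Function.update b j z) =
      Function.update (G.blockApply c b) (c.index j)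
        (G (c.blocksFun (c.index j))
          (Function.update (b ∘ c.embedding (c.index j)) (c.invEmbedding j) z)) := by
  funext k
  by_cases h : k = c.index j
  · subst h
    have hj := Function.update_comp_eq_of_injective b (c.embedding (c.index j)).injective
      (c.invEmbedding j) z
    rw [c.embedding_comp_inv j] at hj
    simp only [Function.update_self, blockApply, hj]
  · have hj : Function.update b j z ∘ c.embedding k = b ∘ c.embedding k :=
      Function.update_comp_eq_of_notMem_range _ _ (by rwa [c.mem_range_embedding_iff'])
    simp only [Function.update_of_ne h, blockApply, hj]

/-- The multilinear map `(b_1, …, b_n) ↦ F_k(G_{p_1}(b_1, …, b_{p_1}), …, G_{p_k}(…, b_n))`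
attached to a composition `c = (p_1, …, p_k)` of `n`. -/
def compTerm (F G : MulSeries B) {n : ℕ} (c : Composition n) :
    MultilinearMap ℂ (fun _ : Fin n => B) B :=
  MultilinearMap.mk' (fun b => F c.length (G.blockApply c b))
    (fun b j u v => by simp only [blockApply_update, MultilinearMap.map_update_add])
    (fun b j a v => by simp only [blockApply_update, MultilinearMap.map_update_smul])

/-- The composition `F ∘ G` (to be used for `G_0 = 0`): the sum, over all `k` and all
`p_1, …, p_k ≥ 1` with `p_1 + ⋯ + p_k = n`, of
`F_k(G_{p_1}(b_1, …, b_{p_1}), …, G_{p_k}(…, b_n))`. For `n = 0` the only summand is the one with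
`k = 0`, that is `F_0`. -/
def comp (F G : MulSeries B) : MulSeries B :=
  fun n => ∑ c : Composition n, compTerm F G c

theorem comp_apply (F G : MulSeries B) (n : ℕ) (b : Fin n → B) :
    F.comp G n b = ∑ c : Composition n,
      F c.length (fun i => G (c.blocksFun i) (b ∘ c.embedding i)) := by
  change (∑ c : Composition n, compTerm F G c) b = _
  rw [sum_apply]
  rfl

end

end MulSeries

namespace OpValued

section

variable {A : Type*} [Ring A] [Algebra ℂ A] {B : Subalgebra ℂ A}

/-- `E : A → B` is a conditional expectation onto the unital subalgebra `B`, so that `(A, B, E)` is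
an operator-valued probability space. -/
structure IsCondExp (E : A →ₗ[ℂ] B) : Prop where
  map_coe : ∀ b : B, E (b : A) = b
  map_bimodule : ∀ (b₁ : B) (a : A) (b₂ : B), E ((b₁ : A) * a * (b₂ : A)) = b₁ * E a * b₂

/-- Freeness with amalgamation over `B` of a family of subalgebras containing `B`: alternating
products of (at least one) centred elements are centred. -/
def FreeSubalgebras (E : A →ₗ[ℂ] B) {ι : Type*} (𝒜 : ι → Subalgebra ℂ A) : Prop :=
  (∀ i, B ≤ 𝒜 i) ∧
    ∀ (n : ℕ) (i : Fin (n + 1) → ι) (a : Fin (n + 1) → A),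
      (∀ j, a j ∈ 𝒜 (i j)) → (∀ j, E (a j) = 0) →
      (∀ j : Fin n, i j.castSucc ≠ i j.succ) →
      E (List.ofFn a).prod = 0

/-- The random variables `x` and `y` are free with amalgamation over `B`: the subalgebras generated
by `B ∪ {x}` and by `B ∪ {y}` are. -/
def FreeVariables (E : A →ₗ[ℂ] B) (x y : A) : Prop :=
  FreeSubalgebras E
    ![Algebra.adjoin ℂ ((B : Set A) ∪ {x}), Algebra.adjoin ℂ ((B : Set A) ∪ {y})]

/-- The moment series `Φ_x`, with terms `(b_1, …, b_n) ↦ E[x b_1 x b_2 x ⋯ b_n x]`. -/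
noncomputable def momentSeries (E : A →ₗ[ℂ] B) (x : A) : MulSeries B := fun n =>
  (E ∘ₗ LinearMap.mulLeft ℂ x).compMultilinearMap
    ((MultilinearMap.mkPiAlgebraFin ℂ n A).compLinearMap
      (fun _ => LinearMap.mulRight ℂ x ∘ₗ B.val.toLinearMap))

theorem momentSeries_apply (E : A →ₗ[ℂ] B) (x : A) (n : ℕ) (b : Fin n → B) :
    momentSeries E x n b = E (x * (List.ofFn fun i => (b i : A) * x).prod) := by
  simp [momentSeries]

/-- `S` is the `S`-transform of `x`: `(1 + I) · χ = I · S`, where `χ` is the series without constant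
term determined by `(I · Φ_x) ∘ χ = I`. -/
def IsSTransform (E : A →ₗ[ℂ] B) (x : A) (S : MulSeries B) : Prop :=
  ∃ χ : MulSeries B, χ 0 = 0 ∧
    (MulSeries.I * momentSeries E x).comp χ = MulSeries.I ∧
    (1 + MulSeries.I) * χ = MulSeries.I * S

end

end OpValued

/-!
The idea is to read a multilinear function series as a function on words and to work in the ring of
such functions with values in `A`, where freeness becomes a statement about series: alternating
products of series of centred elements of the two algebras have expectation `0`. In that ring
`E[(1 - χ x)⁻¹] = 1 + (I Φ_x) ∘ χ` for every `B`-valued `χ` without constant term, because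
composition with `χ` is a ring homomorphism that commutes with `E` and maps `I` to `χ`
(`expect_resolvent`). So `χ_x` is characterized by `E[(1 - χ_x x)⁻¹] = 1 + I`.

The heart is `exists_resolvent_mul`: if `λ` is left cancellable, `μ = (1 - λ)⁻¹`, and
`(1 - λ x')⁻¹`, `(1 - λ y')⁻¹` both have expectation `μ`, with `x'` and `y'` free, then `(1 - λ x' y')⁻¹` has expectation `μ` too. Indeed
`x' (1 - λ x')⁻¹ = μ + ξ` and `y' (1 - λ y')⁻¹ = μ + η` with `ξ`, `η` centred, and
`(1 - λ x')⁻¹ (1 - λ x' y') (1 - λ y')⁻¹ = μ - λ ξ (1 - λ) η = μ (1 - (1 - λ) λ ξ (1 - λ) η)`,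
whence `(1 - λ x' y')⁻¹ = (μ + λ η) (∑ₖ ((1 - λ) λ ξ (1 - λ) η)ᵏ) (1 - λ) (μ + λ ξ)`; apart from the
term `μ (1 - λ) μ = μ`, everything here is a sum of alternating products.

For Dykema's formula (`IsSTransform.mul`) put `w = S_y⁻¹ I S_y`, `λ = (1 + w)⁻¹ w`, `μ = 1 + w`,
`x' = (S_x ∘ w) x` and `y' = y S_y`. Then `λ x' = (χ_x ∘ w) x`, and `λ y'` is conjugate under `S_y`
to `χ_y y`, so the hypotheses hold. Conjugating the conclusion by `S_y` gives
`E[(1 - S_y (χ_x ∘ w) x y)⁻¹] = 1 + I`, that is `χ_{xy} = S_y · χ_x ∘ w`, and the formula follows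
from `(1 + I) S_y = S_y (1 + w)` and `(1 + w) (χ_x ∘ w) = w (S_x ∘ w)`.

Existence and uniqueness of the `S`-transform: with `χ = I σ` the equation `(I Φ_x) ∘ χ = I` reads
`σ (Φ_x ∘ (I σ)) = 1`, which is a fixed point equation for a map whose `n`-th output term depends
only on the terms of `σ` before the `n`-th (`existsUnique_mul_subst_eq_one`).
-/

/-! ### The ring of series on words -/

/-- Functions on finite words over `β` with values in `α`, regarded as formal power series in
noncommuting positions: the value at `[b_1, …, b_n]` is the `n`-th term at `(b_1, …, b_n)`. No
multilinearity is required. -/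
def ListSeries (β α : Type*) : Type _ := List β → α

namespace ListSeries

@[ext]
theorem ext {β α : Type*} {F G : ListSeries β α} (h : ∀ l, F l = G l) : F = G := funext h

/-- The left shift `(b_1, …, b_n) ↦ F(b, b_1, …, b_n)`. -/
def shift {β α : Type*} (b : β) (F : ListSeries β α) : ListSeries β α := fun l => F (b :: l)

section Ring

variable {β α : Type*} [Ring α]

instance : AddCommGroup (ListSeries β α) := inferInstanceAs (AddCommGroup (List β → α))

theorem add_apply (F G : ListSeries β α) (l : List β) : (F + G) l = F l + G l := rfl

theorem sub_apply (F G : ListSeries β α) (l : List β) : (F - G) l = F l - G l := rfl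

theorem zero_apply (l : List β) : (0 : ListSeries β α) l = 0 := rfl

/-- The product of series, the sum over all factorizations of the word into a prefix and a suffix;
here by recursion on the word. -/
def conv : ListSeries β α → ListSeries β α → List β → α
  | F, G, [] => F [] * G []
  | F, G, b :: l => F [] * G (b :: l) + conv (shift b F) G l

instance : Mul (ListSeries β α) := ⟨fun F G => conv F G⟩

/-- The series with constant term `a` and no other terms. -/
def const (a : α) : ListSeries β α
  | [] => a
  | _ :: _ => 0

instance : One (ListSeries β α) := ⟨const 1⟩

theorem mul_nil (F G : ListSeries β α) : (F * G) [] = F [] * G [] := rfl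

theorem mul_cons (F G : ListSeries β α) (b : β) (l : List β) :
    (F * G) (b :: l) = F [] * G (b :: l) + (shift b F * G) l := rfl

theorem const_nil (a : α) : (const a : ListSeries β α) [] = a := rfl

theorem one_nil : (1 : ListSeries β α) [] = 1 := rfl

theorem one_cons (b : β) (l : List β) : (1 : ListSeries β α) (b :: l) = 0 := rfl

theorem shift_const (a : α) (b : β) : shift b (const a : ListSeries β α) = 0 := rfl

theorem shift_add (b : β) (F G : ListSeries β α) : shift b (F + G) = shift b F + shift b G := rfl

protected theorem add_mul' (F G H : ListSeries β α) : (F + G) * H = F * H + G * H := by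
  ext l
  induction l generalizing F G with
  | nil => simp only [mul_nil, add_apply, add_mul]
  | cons b l ih =>
    simp only [mul_cons, add_apply, shift_add, ih, add_mul]
    abel

protected theorem mul_add' (F G H : ListSeries β α) : F * (G + H) = F * G + F * H := by
  ext l
  induction l generalizing F with
  | nil => simp only [mul_nil, add_apply, mul_add]
  | cons b l ih =>
    simp only [mul_cons, add_apply, ih, mul_add]
    abel

protected theorem zero_mul' (F : ListSeries β α) : 0 * F = 0 := by
  have h := ListSeries.add_mul' 0 0 F
  rwa [add_zero, left_eq_add] at h

protected theorem mul_zero' (F : ListSeries β α) : F * 0 = 0 := by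
  have h := ListSeries.mul_add' F 0 0
  rwa [add_zero, left_eq_add] at h

theorem const_mul_apply (a : α) (F : ListSeries β α) (l : List β) :
    (const a * F : ListSeries β α) l = a * F l := by
  cases l with
  | nil => rfl
  | cons b l =>
    rw [mul_cons, shift_const, ListSeries.zero_mul', zero_apply, add_zero, const_nil]

theorem shift_mul (b : β) (F G : ListSeries β α) :
    shift b (F * G) = const (F []) * shift b G + shift b F * G := by
  ext l
  rw [add_apply, const_mul_apply]
  rfl

protected theorem const_mul_assoc (a : α) (F G : ListSeries β α) :
    const a * F * G = const a * (F * G) := by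
  ext l
  induction l generalizing F with
  | nil => simp only [mul_nil, mul_assoc]
  | cons b l ih =>
    rw [const_mul_apply, mul_cons, mul_cons, const_mul_apply, shift_mul, const_nil, shift_const,
      ListSeries.zero_mul', add_zero, ih, const_mul_apply, mul_add, mul_assoc]

protected theorem mul_assoc' (F G H : ListSeries β α) : F * G * H = F * (G * H) := by
  ext l
  induction l generalizing F with
  | nil => simp only [mul_nil, mul_assoc]
  | cons b l ih =>
    rw [mul_cons, mul_cons, mul_cons, shift_mul, ListSeries.add_mul', add_apply, ih,
      ListSeries.const_mul_assoc, const_mul_apply, mul_nil, mul_add, mul_assoc, add_assoc]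

protected theorem one_mul' (F : ListSeries β α) : 1 * F = F := by
  ext l
  exact (const_mul_apply 1 F l).trans (one_mul _)

protected theorem mul_one' (F : ListSeries β α) : F * 1 = F := by
  ext l
  induction l generalizing F with
  | nil => rw [mul_nil, one_nil, mul_one]
  | cons b l ih => rw [mul_cons, ih, one_cons, mul_zero, zero_add]; rfl

instance : Ring (ListSeries β α) where
  __ := (inferInstance : AddCommGroup (ListSeries β α))
  mul_assoc := ListSeries.mul_assoc'
  one_mul := ListSeries.one_mul'
  mul_one := ListSeries.mul_one'
  left_distrib := ListSeries.mul_add'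
  right_distrib := ListSeries.add_mul'
  zero_mul := ListSeries.zero_mul'
  mul_zero := ListSeries.mul_zero'

theorem const_one : (const 1 : ListSeries β α) = 1 := rfl

theorem const_mul_const (a b : α) : (const a * const b : ListSeries β α) = const (a * b) := by
  ext l
  rw [const_mul_apply]
  cases l with
  | nil => rfl
  | cons => exact mul_zero a

theorem mul_eq_sum (F G : ListSeries β α) (l : List β) :
    (F * G) l = ∑ k ∈ Finset.range (l.length + 1), F (l.take k) * G (l.drop k) := by
  induction l generalizing F with
  | nil => simp [mul_nil]
  | cons b l ih =>
    rw [mul_cons, List.length_cons, Finset.sum_range_succ', ih]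
    simp only [List.take_succ_cons, List.drop_succ_cons, List.take_zero, List.drop_zero, shift]
    exact add_comm _ _

/-- Products of series respect pointwise membership in additive subgroups. -/
theorem mul_mem {P Q R : AddSubgroup α} (h : ∀ a ∈ P, ∀ b ∈ Q, a * b ∈ R)
    {F G : ListSeries β α} (hF : ∀ l, F l ∈ P) (hG : ∀ l, G l ∈ Q) (l : List β) :
    (F * G) l ∈ R := by
  rw [mul_eq_sum]
  exact sum_mem fun k _ => h _ (hF _) _ (hG _)

/-- Powers of a series without constant term vanish on short words. -/
theorem pow_mul_apply_eq_zero {F : ListSeries β α} (hF : F [] = 0) (G : ListSeries β α)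
    (n : ℕ) (l : List β) (hl : l.length < n) : (F ^ n * G) l = 0 := by
  induction n generalizing l with
  | zero => omega
  | succ n ih =>
    rw [pow_succ', mul_assoc, mul_eq_sum]
    refine Finset.sum_eq_zero fun k hk => ?_
    rcases Nat.eq_zero_or_pos k with rfl | hk0
    · rw [List.take_zero, hF, zero_mul]
    · by_cases hd : l.length = 0
      · rw [List.length_eq_zero_iff.1 hd, List.take_nil, hF, zero_mul]
      · rw [ih _ (by rw [List.length_drop]; omega), mul_zero]

/-- Unfolding the recursion `Z = Z₀ + F Z` with `F` without constant term expresses each term of `Z`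
as a finite geometric sum, so that pointwise membership passes from `Z₀` to `Z`. -/
theorem mem_of_eq_add_mul {P : AddSubgroup α} {F Z₀ Z : ListSeries β α} (hF : F [] = 0)
    (hZ : Z = Z₀ + F * Z) (h₀ : ∀ l, Z₀ l ∈ P)
    (hP : ∀ G : ListSeries β α, (∀ l, G l ∈ P) → ∀ l, (F * G) l ∈ P) (l : List β) : Z l ∈ P := by
  have key : ∀ n, ∃ G : ListSeries β α, (∀ l, G l ∈ P) ∧ Z = G + F ^ n * Z := by
    intro n
    induction n with
    | zero => exact ⟨0, fun _ => P.zero_mem, by simp⟩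
    | succ n ih =>
      obtain ⟨G, hG, h⟩ := ih
      refine ⟨Z₀ + F * G, fun l => P.add_mem (h₀ l) (hP G hG l), ?_⟩
      conv_lhs => rw [hZ, h]
      rw [mul_add, pow_succ', mul_assoc, add_assoc]
  obtain ⟨G, hG, h⟩ := key (l.length + 1)
  rw [h, add_apply, pow_mul_apply_eq_zero hF Z _ l (Nat.lt_succ_self _), add_zero]
  exact hG l

/-- A series `1 - F` with `F` without constant term is invertible (Neumann series). -/
theorem isUnit_one_sub {F : ListSeries β α} (hF : F [] = 0) : IsUnit (1 - F) := by
  let G : ListSeries β α := fun l => ∑ k ∈ Finset.range (l.length + 1), (F ^ k) l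
  have sum_apply : ∀ (n : ℕ) (l : List β),
      (∑ k ∈ Finset.range n, F ^ k) l = ∑ k ∈ Finset.range n, (F ^ k) l :=
    fun n l => Finset.sum_apply l _ _
  have hG : ∀ (n : ℕ) (l : List β), l.length < n → G l = (∑ k ∈ Finset.range n, F ^ k) l := by
    intro n l hl
    rw [sum_apply]
    refine Finset.sum_subset (Finset.range_mono hl) fun k _ hk => ?_
    have := pow_mul_apply_eq_zero hF 1 k l (by simpa using hk)
    rwa [mul_one] at this
  have hpow : ∀ l : List β, (F ^ (l.length + 1)) l = 0 := fun l => by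
    simpa using pow_mul_apply_eq_zero hF 1 (l.length + 1) l (Nat.lt_succ_self _)
  refine ⟨⟨1 - F, G, ?_, ?_⟩, rfl⟩
  · ext l
    have : ((1 - F) * G) l = ((1 - F) * ∑ k ∈ Finset.range (l.length + 1), F ^ k) l := by
      rw [mul_eq_sum, mul_eq_sum]
      refine Finset.sum_congr rfl fun k _ => ?_
      rw [hG (l.length + 1) (l.drop k) (by rw [List.length_drop]; omega)]
    rw [this, mul_neg_geom_sum, sub_apply, hpow, sub_zero]
  · ext l
    have : (G * (1 - F)) l = ((∑ k ∈ Finset.range (l.length + 1), F ^ k) * (1 - F)) l := by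
      rw [mul_eq_sum, mul_eq_sum]
      refine Finset.sum_congr rfl fun k _ => ?_
      rw [hG (l.length + 1) (l.take k) (by rw [List.length_take]; omega)]
    rw [this, geom_sum_mul_neg, sub_apply, hpow, sub_zero]

/-- The series `I`, with linear term `b ↦ b`; over a general value ring the linear term is a given
function `f`. -/
def linear (f : β → α) : ListSeries β α
  | [b] => f b
  | _ => 0

theorem linear_nil (f : β → α) : linear f [] = 0 := rfl

theorem shift_linear (f : β → α) (b : β) : shift b (linear f) = const (f b) := by
  ext l
  cases l <;> rfl

theorem linear_mul_cons (f : β → α) (F : ListSeries β α) (b : β) (l : List β) :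
    (linear f * F) (b :: l) = f b * F l := by
  rw [mul_cons, linear_nil, zero_mul, zero_add, shift_linear, const_mul_apply]

end Ring

section Map

variable {β α γ : Type*} [Ring α] [Ring γ]

/-- Termwise application of an additive map. -/
def map (f : α →+ γ) (F : ListSeries β α) : ListSeries β γ := fun l => f (F l)

theorem map_add (f : α →+ γ) (F G : ListSeries β α) : map f (F + G) = map f F + map f G :=
  funext fun _ => _root_.map_add f _ _

theorem map_const (f : α →+ γ) (a : α) : map f (const a : ListSeries β α) = const (f a) := by
  ext l
  cases l with
  | nil => rfl
  | cons => exact map_zero f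

theorem shift_map (f : α →+ γ) (b : β) (F : ListSeries β α) :
    shift b (map f F) = map f (shift b F) := rfl

theorem map_linear (f : α →+ γ) (g : β → α) : map f (linear g) = linear fun b => f (g b) := by
  ext l
  match l with
  | [] => exact map_zero f
  | [b] => rfl
  | _ :: _ :: _ => exact map_zero f

/-- Termwise application of a ring homomorphism. -/
def mapHom (f : α →+* γ) : ListSeries β α →+* ListSeries β γ where
  toFun := map f.toAddMonoidHom
  map_one' := by
    rw [← const_one, map_const]
    exact congrArg const (map_one f)
  map_mul' F G := by
    ext l
    induction l generalizing F with
    | nil => exact map_mul f _ _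
    | cons b l ih =>
      rw [mul_cons, shift_map, ← ih]
      change f (F [] * G (b :: l) + (shift b F * G) l) = f _ * f _ + f _
      rw [_root_.map_add, map_mul]
  map_zero' := funext fun _ => map_zero f
  map_add' := map_add _

theorem mapHom_linear (f : α →+* γ) (g : β → α) :
    mapHom f (linear g) = linear fun b => f (g b) := map_linear f.toAddMonoidHom g

end Map

/-! ### Composition of series -/

section Subst

variable {β α γ : Type*} [Ring α] [Ring γ]

/-- The sum over all ways to cut `l` into blocks, where the first block is the (possibly empty)
remainder of a nonempty block already begun: its contribution as a function of this remainder is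
`H`, the other blocks contribute their values under `G`, and the results are the arguments
of `F`. -/
def substAux (G : ListSeries β β) : ListSeries β β → ListSeries β α → ListSeries β α
  | H, F, [] => F [H []]
  | H, F, b :: l => substAux G (shift b H) F l + substAux G (shift b G) (shift (H []) F) l

/-- The composition `F ∘ G`: the sum over all ways to cut the word into nonempty blocks; the
arguments of `F` are the values of `G` at the blocks. The constant term of `G` does not
enter. -/
def subst (G : ListSeries β β) (F : ListSeries β α) : ListSeries β α
  | [] => F []
  | b :: l => substAux G (shift b G) F l

theorem subst_nil (G : ListSeries β β) (F : ListSeries β α) : subst G F [] = F [] := rfl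

theorem substAux_add (G H : ListSeries β β) (F F' : ListSeries β α) (l : List β) :
    substAux G H (F + F') l = substAux G H F l + substAux G H F' l := by
  induction l generalizing H F F' with
  | nil => rfl
  | cons b l ih =>
    simp only [substAux, shift_add, ih]
    abel

theorem substAux_const_mul (G H : ListSeries β β) (a : α) (F : ListSeries β α) (l : List β) :
    substAux G H (const a * F) l = a * substAux G H F l := by
  induction l generalizing H F with
  | nil => simp only [substAux, const_mul_apply]
  | cons b l ih =>
    simp only [substAux, shift_mul, shift_const, zero_mul, add_zero, const_nil, ih, mul_add]

theorem shift_substAux (G H : ListSeries β β) (F : ListSeries β α) (b : β) :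
    shift b (substAux G H F) = substAux G (shift b H) F + substAux G (shift b G) (shift (H []) F) :=
  rfl

theorem substAux_mul (G H : ListSeries β β) (F K : ListSeries β α) :
    substAux G H (F * K) = const (F []) * substAux G H K + substAux G H F * subst G K := by
  ext l
  rw [add_apply, const_mul_apply]
  induction l generalizing H F with
  | nil => rfl
  | cons b l ih =>
    simp only [substAux, shift_mul, substAux_add, substAux_const_mul, add_apply, ih, mul_cons,
      shift_substAux, add_mul, mul_add, subst]
    simp only [shift]
    abel

theorem substAux_const (G H : ListSeries β β) (a : α) : substAux G H (const a) = 0 := by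
  ext l
  induction l generalizing H a with
  | nil => rfl
  | cons b l ih =>
    have := substAux_const_mul G (shift b G) (0 : α) (0 : ListSeries β α) l
    rw [mul_zero, zero_mul] at this
    simp only [substAux, shift_const, ih, this, zero_apply, add_zero]

theorem subst_add (G : ListSeries β β) (F F' : ListSeries β α) :
    subst G (F + F') = subst G F + subst G F' := by
  ext l
  cases l with
  | nil => rfl
  | cons b l => exact substAux_add _ _ _ _ _

theorem subst_mul (G : ListSeries β β) (F F' : ListSeries β α) :
    subst G (F * F') = subst G F * subst G F' := by
  ext l
  cases l with
  | nil => rfl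
  | cons b l =>
    change substAux G (shift b G) (F * F') l = _
    rw [substAux_mul, add_apply, const_mul_apply]
    rfl

theorem subst_const (G : ListSeries β β) (a : α) : subst G (const a) = const a := by
  ext l
  cases l with
  | nil => rfl
  | cons b l => exact congrFun (substAux_const G _ a) l

/-- Composition with a fixed inner series is a ring homomorphism in the outer series. -/
def substHom (G : ListSeries β β) : ListSeries β α →+* ListSeries β α where
  toFun := subst G
  map_one' := subst_const G 1
  map_mul' := subst_mul G
  map_zero' := by simpa using subst_add G (0 : ListSeries β α) 0
  map_add' := subst_add G

theorem substHom_apply (G : ListSeries β β) (F : ListSeries β α) : substHom G F = subst G F := rfl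

theorem substAux_linear (G H : ListSeries β β) (f : β → α) (l : List β) :
    substAux G H (linear f) l = f (H l) := by
  induction l generalizing H with
  | nil => rfl
  | cons b l ih =>
    simp only [substAux, shift_linear, substAux_const, ih, zero_apply, add_zero, shift]

/-- Composition of the series `I` with a series without constant term. -/
theorem subst_linear {G : ListSeries β β} {f : β → α} (hG : f (G []) = 0) :
    subst G (linear f) = fun l => f (G l) := by
  ext l
  cases l with
  | nil => exact hG.symm
  | cons b l => exact substAux_linear G _ f l

/-- Composition commutes with termwise application of an additive map. -/
theorem map_subst (f : α →+ γ) (G : ListSeries β β) (F : ListSeries β α) :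
    map f (subst G F) = subst G (map f F) := by
  have aux (H : ListSeries β β) (F : ListSeries β α) (l : List β) :
      f (substAux G H F l) = substAux G H (map f F) l := by
    induction l generalizing H F with
    | nil => rfl
    | cons b l ih => simp only [substAux, _root_.map_add, ih, shift_map]
  ext l
  cases l with
  | nil => rfl
  | cons b l => exact aux _ _ _

/-- Composition, organized according to the length `k + 1` of the first block. -/
theorem subst_cons (G : ListSeries β β) (F : ListSeries β α) (b : β) (l : List β) :
    subst G F (b :: l) = ∑ k ∈ Finset.range (l.length + 1),
      subst G (shift (G (b :: l.take k)) F) (l.drop k) := by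
  have aux (H : ListSeries β β) (F : ListSeries β α) (l : List β) :
      substAux G H F l = ∑ k ∈ Finset.range (l.length + 1),
        subst G (shift (H (l.take k)) F) (l.drop k) := by
    induction l generalizing H F with
    | nil => simp [substAux, subst, shift]
    | cons b l ih =>
      rw [List.length_cons, Finset.sum_range_succ']
      simp only [List.take_succ_cons, List.drop_succ_cons, List.take_zero, List.drop_zero]
      exact congrArg₂ (· + ·) (ih (shift b H) F) rfl
  exact aux _ _ _

end Subst

end ListSeries

/-! ### Fixed points of strictly causal maps -/

section Causal

variable {X : ℕ → Type*}

/-- A strictly causal map of sequences, whose `n`-th output term depends only on the input terms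
before the `n`-th, has exactly one fixed point. -/
theorem existsUnique_fixedPoint_of_causal [∀ n, Nonempty (X n)] (T : (∀ n, X n) → ∀ n, X n)
    (hT : ∀ n F G, (∀ k < n, F k = G k) → T F n = T G n) : ∃! F, T F = F := by
  have F₀ : ∀ n, X n := fun n => Classical.arbitrary _
  let F : ∀ n, X n := fun n => T^[n + 1] F₀ n
  have key : ∀ k m, k < m → T^[m] F₀ k = F k := by
    intro k
    induction k using Nat.strong_induction_on with
    | _ k ih =>
      intro m hm
      obtain ⟨m, rfl⟩ := Nat.exists_eq_succ_of_ne_zero (Nat.ne_zero_of_lt hm)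
      simp only [F, Function.iterate_succ_apply']
      exact hT k _ _ fun j hj => (ih j hj m (by omega)).trans (ih j hj k hj).symm
  refine ⟨F, funext fun n => ?_, fun G hG => funext fun n => ?_⟩
  · simp only [F, Function.iterate_succ_apply']
    refine hT n _ _ fun k hk => ?_
    rw [key k n hk]
    simp only [F, Function.iterate_succ_apply']
  · induction n using Nat.strong_induction_on with
    | _ n ih =>
      rw [← hG]
      simp only [F, Function.iterate_succ_apply']
      refine hT n _ _ fun k hk => ?_
      rw [ih k hk, key k n hk]

end Causal

/-! ### Multilinear function series as series on words -/

/-- Removing the first block of a composition of `n + 1`, of size `k + 1`, leaves a composition of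
`n - k`. -/
theorem Composition.sum_blocks_succ {M : Type*} [AddCommMonoid M] (n : ℕ) (f : List ℕ → M) :
    ∑ c : Composition (n + 1), f c.blocks =
      ∑ k ∈ Finset.range (n + 1), ∑ c : Composition (n - k), f ((k + 1) :: c.blocks) := by
  rw [Finset.sum_sigma']
  symm
  refine Finset.sum_bij
    (fun p hp => (⟨(p.1 + 1) :: p.2.blocks, ?_, ?_⟩ : Composition (n + 1))) ?_ ?_ ?_ ?_
  · intro i hi
    rcases List.mem_cons.1 hi with rfl | hi
    · exact Nat.succ_pos _
    · exact p.2.blocks_pos hi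
  · have := p.2.blocks_sum
    have := Finset.mem_range.1 (Finset.mem_sigma.1 hp).1
    rw [List.sum_cons]
    omega
  · exact fun _ _ => Finset.mem_univ _
  · rintro ⟨k, c⟩ hc ⟨k', c'⟩ hc' h
    simp only [Composition.mk.injEq, List.cons.injEq, Nat.add_right_cancel_iff] at h
    obtain ⟨rfl, h⟩ := h
    rw [Composition.ext h]
  · rintro ⟨bs, hpos, hsum⟩ -
    rcases bs with _ | ⟨b, bs⟩
    · simp at hsum
    · have hb : 0 < b := hpos (by simp)
      rw [List.sum_cons] at hsum
      refine ⟨⟨b - 1, ⟨bs, fun hi => hpos (List.mem_cons_of_mem _ hi), by omega⟩⟩, ?_, ?_⟩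
      · simp only [Finset.mem_sigma, Finset.mem_range, Finset.mem_univ, and_true]
        omega
      · simp only [Composition.mk.injEq, List.cons.injEq, and_true]
        omega
  · exact fun _ _ => rfl

/-- The recursively defined composition of series as a sum over compositions of integers. -/
theorem ListSeries.subst_eq_sum {β α : Type*} [Ring α] (G : ListSeries β β) (F : ListSeries β α)
    (l : List β) {n : ℕ} (hn : l.length = n) :
    subst G F l = ∑ c : Composition n, F ((l.splitWrtComposition c).map fun b => G b) := by
  induction n using Nat.strong_induction_on generalizing l F with
  | _ n ih =>
    match l, n, hn with
    | [], 0, _ =>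
      have : Subsingleton (Composition 0) := ⟨fun c c' => Composition.ext <| by
        rw [c.blocks_eq_nil.2 rfl, c'.blocks_eq_nil.2 rfl]⟩
      rw [Fintype.sum_subsingleton _ (Composition.ones 0), List.splitWrtComposition,
        Composition.ones_blocks, List.replicate_zero]
      rw [List.splitWrtCompositionAux]
      rfl
    | b :: l, n + 1, hn =>
      rw [List.length_cons, Nat.add_right_cancel_iff] at hn
      simp only [List.splitWrtComposition]
      rw [Composition.sum_blocks_succ n fun bs =>
          F ((List.splitWrtCompositionAux (b :: l) bs).map fun b => G b),
        subst_cons, hn]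
      refine Finset.sum_congr rfl fun k _ => ?_
      rw [ih (n - k) (by omega) _ _ (by rw [List.length_drop, hn])]
      refine Finset.sum_congr rfl fun c _ => ?_
      rw [List.splitWrtCompositionAux_cons]
      rfl

namespace MulSeries

variable {B : Type*} [Ring B] [Algebra ℂ B]

/-- The values of all terms of a multilinear function series as a function on words. -/
def toList (F : MulSeries B) : ListSeries B B := fun l => F l.length l.get

theorem toList_apply (F : MulSeries B) {l : List B} {n : ℕ} {b : Fin n → B} (hn : l.length = n)
    (hb : ∀ (i : ℕ) (h : i < n), l[i] = b ⟨i, h⟩) : F.toList l = F n b := by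
  subst hn
  exact congrArg (F _) (funext fun i => hb i i.2)

theorem toList_ofFn (F : MulSeries B) {n : ℕ} (b : Fin n → B) : F.toList (List.ofFn b) = F n b :=
  F.toList_apply List.length_ofFn fun i h => by simp

theorem toList_injective : Function.Injective (toList (B := B)) := fun F G h =>
  funext fun n => MultilinearMap.ext fun b => by rw [← toList_ofFn, h, toList_ofFn]

theorem toList_add (F G : MulSeries B) : (F + G).toList = F.toList + G.toList := rfl

theorem toList_sub (F G : MulSeries B) : (F - G).toList = F.toList - G.toList := rfl

/-- The series with constant term `a` and no other terms. -/
def const (a : B) : MulSeries B := fun n => match n with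
  | 0 => MultilinearMap.constOfIsEmpty ℂ _ a
  | _ + 1 => 0

theorem toList_const (a : B) : (const a).toList = ListSeries.const a := by
  ext l
  cases l <;> rfl

theorem toList_one : (1 : MulSeries B).toList = 1 := toList_const 1

theorem toList_I : (I : MulSeries B).toList = ListSeries.linear fun b => b := by
  ext l
  match l with
  | [] => rfl
  | [b] => rfl
  | _ :: _ :: _ => rfl

theorem toList_mul (F G : MulSeries B) : (F * G).toList = F.toList * G.toList := by
  ext l
  rw [toList, mul_apply, ListSeries.mul_eq_sum, Finset.sum_range]
  refine Finset.sum_congr rfl fun k _ => ?_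
  congr 1
  · exact (F.toList_apply (by rw [List.length_take]; omega) fun i h => by simp).symm
  · exact (G.toList_apply (by rw [List.length_drop]) fun i h => by simp).symm

theorem toList_comp (F G : MulSeries B) :
    (F.comp G).toList = ListSeries.subst G.toList F.toList := by
  ext l
  rw [toList, comp_apply, ListSeries.subst_eq_sum _ _ l rfl]
  refine Finset.sum_congr rfl fun c _ => (F.toList_apply ?_ fun i h => ?_).symm
  · rw [List.length_map, List.length_splitWrtComposition]
  · have hi : i < (l.splitWrtComposition c).length := by rwa [List.length_splitWrtComposition]
    rw [List.getElem_map, List.getElem_splitWrtComposition]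
    have hs := c.sizeUpTo_succ h
    have hle := c.sizeUpTo_le (i + 1)
    refine G.toList_apply ?_ fun m hm => ?_
    · rw [List.length_drop, List.length_take]
      change _ = c.blocks[i]
      omega
    · simp [Composition.embedding]

theorem existsUnique_fixedPoint (T : MulSeries B → MulSeries B)
    (hT : ∀ (n : ℕ) (F G : MulSeries B), (∀ k < n, F k = G k) → T F n = T G n) : ∃! F, T F = F :=
  existsUnique_fixedPoint_of_causal T hT

theorem mul_congr {F F' G G' : MulSeries B} {n : ℕ}
    (h : ∀ k ≤ n, ∀ b b', F k b * G (n - k) b' = F' k b * G' (n - k) b') :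
    (F * G) n = (F' * G') n := by
  ext b
  rw [mul_apply, mul_apply]
  exact Finset.sum_congr rfl fun k _ => h k (by omega) _ _

theorem comp_congr {F G G' : MulSeries B} {n : ℕ} (h : ∀ k ≤ n, G k = G' k) :
    F.comp G n = F.comp G' n := by
  ext b
  rw [comp_apply, comp_apply]
  refine Finset.sum_congr rfl fun c _ => congrArg _ (funext fun i => ?_)
  rw [h _ (c.blocksFun_le i)]

theorem I_mul_congr {F F' : MulSeries B} {n : ℕ} (h : ∀ k < n, F k = F' k) :
    (I * F : MulSeries B) n = (I * F' : MulSeries B) n := by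
  refine mul_congr fun k hk b b' => ?_
  rcases Nat.eq_zero_or_pos k with rfl | hk0
  · change 0 * _ = 0 * _
    rw [zero_mul, zero_mul]
  · rw [h (n - k) (by omega)]

/-- A series with invertible constant term is multiplicatively invertible. -/
theorem exists_mul_eq_one (F : MulSeries B) (hF : IsUnit (F.toList [])) :
    ∃ G : MulSeries B, F.toList * G.toList = 1 ∧ G.toList * F.toList = 1 := by
  have right (F : MulSeries B) (hF : IsUnit (F.toList [])) :
      ∃ G : MulSeries B, F.toList * G.toList = 1 := by
    obtain ⟨e, he⟩ := hF
    have h0 : ∀ b : Fin 0 → B, (F - const (e : B)) 0 b = 0 := fun b => by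
      rw [← toList_ofFn, toList_sub, toList_const, List.ofFn_zero, ListSeries.sub_apply, ← he,
        ListSeries.const_nil, sub_self]
    obtain ⟨G, hG, -⟩ := existsUnique_fixedPoint
      (fun G => const (↑e⁻¹ : B) * (1 - (F - const (e : B)) * G)) (by
        intro n G G' h
        refine mul_congr fun k _ b b' => congrArg _ ?_
        have : ((F - const (e : B)) * G : MulSeries B) (n - k) =
            ((F - const (e : B)) * G' : MulSeries B) (n - k) := by
          refine mul_congr fun m hm c c' => ?_
          rcases Nat.eq_zero_or_pos m with rfl | hm0
          · rw [h0, zero_mul, zero_mul]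
          · rw [h (n - k - m) (by omega)]
        exact congrArg (fun K => ((1 : MulSeries B) (n - k) - K) b') this)
    refine ⟨G, ?_⟩
    have h := congrArg (fun K => ListSeries.const (e : B) * toList K) hG
    simp only [toList_mul, toList_sub, toList_const, toList_one] at h
    rw [← mul_assoc, ListSeries.const_mul_const, Units.mul_inv, ListSeries.const_one, one_mul,
      sub_mul, sub_eq_iff_eq_add] at h
    exact (h.trans (add_sub_cancel _ _)).symm
  obtain ⟨G, hG⟩ := right F hF
  have h0 : F.toList [] * G.toList [] = 1 := congrFun hG []
  obtain ⟨H, hH⟩ := right G <| by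
    obtain ⟨e, he⟩ := hF
    rw [← he] at h0
    exact ⟨e⁻¹, (Units.eq_inv_of_mul_eq_one_left h0).symm⟩
  refine ⟨G, hG, ?_⟩
  rwa [← left_inv_eq_right_inv hG hH] at hH

end MulSeries

/-! ### Freeness of series and the product of resolvents -/

namespace OpValued

variable {A : Type*} [Ring A] [Algebra ℂ A] {B : Subalgebra ℂ A}

section Words

variable {ι : Type*}

/-- The elements of `𝒜` with vanishing conditional expectation. -/
def centred (E : A →ₗ[ℂ] B) (𝒜 : Subalgebra ℂ A) : AddSubgroup A where
  carrier := {a | a ∈ 𝒜 ∧ E a = 0}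
  zero_mem' := ⟨𝒜.zero_mem, map_zero E⟩
  add_mem' ha hb := ⟨𝒜.add_mem ha.1 hb.1, by rw [map_add, ha.2, hb.2, add_zero]⟩
  neg_mem' ha := ⟨𝒜.neg_mem ha.1, by rw [map_neg, ha.2, neg_zero]⟩

/-- The additive span of the alternating products of centred elements with first factor
from `𝒜 i`. -/
def words (E : A →ₗ[ℂ] B) (𝒜 : ι → Subalgebra ℂ A) (i : ι) : AddSubgroup A :=
  AddSubgroup.closure {w | ∃ (n : ℕ) (k : Fin (n + 1) → ι) (a : Fin (n + 1) → A), k 0 = i ∧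
    (∀ j, a j ∈ 𝒜 (k j)) ∧ (∀ j, E (a j) = 0) ∧ (∀ j : Fin n, k j.castSucc ≠ k j.succ) ∧
    (List.ofFn a).prod = w}

theorem map_words {E : A →ₗ[ℂ] B} {𝒜 : ι → Subalgebra ℂ A} (h : FreeSubalgebras E 𝒜) {i : ι} {w : A}
    (hw : w ∈ words E 𝒜 i) : E w = 0 := by
  induction hw using AddSubgroup.closure_induction with
  | mem w hw =>
    obtain ⟨n, k, a, -, h₁, h₂, h₃, rfl⟩ := hw
    exact h.2 n k a h₁ h₂ h₃
  | zero => exact map_zero E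
  | add v w _ _ hv hw => rw [map_add, hv, hw, add_zero]
  | neg w _ hw => rw [map_neg, hw, neg_zero]

theorem centred_le_words (E : A →ₗ[ℂ] B) (𝒜 : ι → Subalgebra ℂ A) (i : ι) :
    centred E (𝒜 i) ≤ words E 𝒜 i := fun a ha =>
  AddSubgroup.subset_closure ⟨0, fun _ => i, fun _ => a, rfl, fun _ => ha.1, fun _ => ha.2,
    fun j => j.elim0, by simp⟩

theorem mul_mem_words {E : A →ₗ[ℂ] B} {𝒜 : ι → Subalgebra ℂ A} {i j : ι} (hij : i ≠ j) {a w : A}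
    (ha : a ∈ centred E (𝒜 i)) (hw : w ∈ words E 𝒜 j) : a * w ∈ words E 𝒜 i := by
  induction hw using AddSubgroup.closure_induction with
  | mem w hw =>
    obtain ⟨n, k, c, hk, h₁, h₂, h₃, rfl⟩ := hw
    refine AddSubgroup.subset_closure ⟨n + 1, Fin.cons i k, Fin.cons a c, rfl, ?_, ?_, ?_, ?_⟩
    · exact Fin.cases ha.1 h₁
    · exact Fin.cases ha.2 h₂
    · refine Fin.cases ?_ h₃
      change i ≠ k 0
      rwa [hk]
    · simp [List.ofFn_succ]
  | zero => rw [mul_zero]; exact zero_mem _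
  | add v w _ _ hv hw => rw [mul_add]; exact add_mem hv hw
  | neg w _ hw => rw [mul_neg]; exact neg_mem hw

end Words

/-- The ring homomorphism that views series with values in `B` as series with values in `A`. -/
def incl (B : Subalgebra ℂ A) : ListSeries B B →+* ListSeries B A :=
  ListSeries.mapHom B.val.toRingHom

/-- Termwise conditional expectation. -/
def expect (E : A →ₗ[ℂ] B) : ListSeries B A →+ ListSeries B B where
  toFun := ListSeries.map E.toAddMonoidHom
  map_zero' := funext fun _ => map_zero E
  map_add' := ListSeries.map_add _

theorem incl_apply (F : ListSeries B B) (l : List B) : incl B F l = F l := rfl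

theorem expect_apply (E : A →ₗ[ℂ] B) (F : ListSeries B A) (l : List B) :
    expect E F l = E (F l) := rfl

theorem incl_mul_nil {F : ListSeries B B} (hF : F [] = 0) (G : ListSeries B A) :
    (incl B F * G : ListSeries B A) [] = 0 := by
  rw [ListSeries.mul_nil, incl_apply, hF, ZeroMemClass.coe_zero, zero_mul]

theorem mul_mem_subalgebra (𝒜 : Subalgebra ℂ A) {F G : ListSeries B A} (hF : ∀ l, F l ∈ 𝒜)
    (hG : ∀ l, G l ∈ 𝒜) (l : List B) : (F * G : ListSeries B A) l ∈ 𝒜 :=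
  ListSeries.mul_mem (P := 𝒜.toSubring.toAddSubgroup) (Q := 𝒜.toSubring.toAddSubgroup)
    (R := 𝒜.toSubring.toAddSubgroup) (fun _ ha _ hb => 𝒜.mul_mem ha hb) hF hG l

section Expect

variable {E : A →ₗ[ℂ] B}

theorem expect_incl (hE : IsCondExp E) (F : ListSeries B B) : expect E (incl B F) = F :=
  funext fun l => hE.map_coe (F l)

theorem expect_incl_mul (hE : IsCondExp E) (F : ListSeries B B) (G : ListSeries B A) :
    expect E (incl B F * G) = F * expect E G := by
  ext l
  simp only [expect_apply, ListSeries.mul_eq_sum, map_sum, incl_apply]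
  refine congrArg _ (Finset.sum_congr rfl fun k _ => ?_)
  simpa using hE.map_bimodule (F (l.take k)) (G (l.drop k)) 1

theorem expect_mul_incl (hE : IsCondExp E) (F : ListSeries B B) (G : ListSeries B A) :
    expect E (G * incl B F) = expect E G * F := by
  ext l
  simp only [expect_apply, ListSeries.mul_eq_sum, map_sum, incl_apply]
  refine congrArg _ (Finset.sum_congr rfl fun k _ => ?_)
  simpa using hE.map_bimodule 1 (G (l.take k)) (F (l.drop k))

/-- If `λ` is left cancellable, `1 - λ` is inverse to `μ`, and both `(1 - λ x)⁻¹` and `(1 - λ y)⁻¹` have expectation `μ`,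
where `x` and `y` come from different algebras of a free family, then so does `(1 - λ x y)⁻¹`.
The elements `x (1 - λ x)⁻¹` and `y (1 - λ y)⁻¹` have expectation `μ`; in terms of their centred
parts `ξ` and `η`, `(1 - λ x)⁻¹ (1 - λ x y) (1 - λ y)⁻¹ = μ - λ ξ (1 - λ) η`, and inverting
this by a Neumann series exhibits `(1 - λ x y)⁻¹` as `μ` plus alternating products. -/
theorem exists_resolvent_mul {ι : Type*} (hE : IsCondExp E) {𝒜 : ι → Subalgebra ℂ A}
    (hfree : FreeSubalgebras E 𝒜) {i j : ι} (hij : i ≠ j) {x y : ListSeries B A}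
    (hx : ∀ l, x l ∈ 𝒜 i) (hy : ∀ l, y l ∈ 𝒜 j) {lam mu : ListSeries B B} (h0 : lam [] = 0)
    (hlm : (1 - lam) * mu = 1) (hml : mu * (1 - lam) = 1)
    (hcancel : ∀ F G, lam * F = lam * G → F = G) {Z₁ Z₂ : ListSeries B A}
    (hZ₁ : (1 - incl B lam * x) * Z₁ = 1) (hE₁ : expect E Z₁ = mu)
    (hZ₂ : (1 - incl B lam * y) * Z₂ = 1) (hE₂ : expect E Z₂ = mu) :
    ∃ Q, (1 - incl B lam * x * y) * Q = 1 ∧ expect E Q = mu := by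
  have incl_mem (k : ι) (F : ListSeries B B) (l : List B) : incl B F l ∈ 𝒜 k :=
    hfree.1 k (F l).2
  have eq_one_add {x Z : ListSeries B A} (hZ : (1 - incl B lam * x) * Z = 1) :
      Z = 1 + incl B lam * (x * Z) := by
    rw [sub_mul, one_mul, sub_eq_iff_eq_add, mul_assoc] at hZ
    exact hZ
  have centred_part (k : ι) {x Z : ListSeries B A} (hx : ∀ l, x l ∈ 𝒜 k)
      (hZ : (1 - incl B lam * x) * Z = 1) (hEZ : expect E Z = mu) :
      ∃ ξ : ListSeries B A, (∀ l, ξ l ∈ centred E (𝒜 k)) ∧ x * Z = incl B mu + ξ := by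
    have hmem : ∀ l, Z l ∈ 𝒜 k :=
      ListSeries.mem_of_eq_add_mul (P := (𝒜 k).toSubring.toAddSubgroup) (incl_mul_nil h0 x)
        (Z₀ := 1) ((eq_one_add hZ).trans (by rw [mul_assoc]))
        (fun l => by
          have h := incl_mem k 1 l
          rwa [map_one] at h)
        fun G hG => mul_mem_subalgebra _ (mul_mem_subalgebra _ (incl_mem k lam) hx) hG
    have hexp : expect E (x * Z) = mu := by
      apply hcancel
      rw [← expect_incl_mul hE, ← add_right_inj (1 : ListSeries B B)]
      have h := congrArg (expect E) (eq_one_add hZ)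
      rw [map_add, hEZ, ← map_one (incl B), expect_incl hE] at h
      rw [← h, ← sub_eq_iff_eq_add, ← hlm, sub_mul, one_mul]
    refine ⟨x * Z - incl B mu, fun l => ⟨?_, ?_⟩, by abel⟩
    · exact (𝒜 k).sub_mem (mul_mem_subalgebra _ hx hmem l) (incl_mem k mu l)
    · have h : expect E (x * Z - incl B mu) = 0 := by
        rw [map_sub, hexp, expect_incl hE, sub_self]
      exact congrFun h l
  obtain ⟨ξ, hξ, hX⟩ := centred_part i hx hZ₁ hE₁
  obtain ⟨η, hη, hY⟩ := centred_part j hy hZ₂ hE₂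
  have left_mem (k : ι) (F : ListSeries B B) {ζ : ListSeries B A}
      (hζ : ∀ l, ζ l ∈ centred E (𝒜 k)) : ∀ l, (incl B F * ζ) l ∈ centred E (𝒜 k) :=
    ListSeries.mul_mem (P := B.toSubring.toAddSubgroup) (Q := centred E (𝒜 k))
      (R := centred E (𝒜 k)) (fun b hb a ha =>
        ⟨(𝒜 k).mul_mem (hfree.1 k hb) ha.1, by
          simpa [ha.2] using hE.map_bimodule ⟨b, hb⟩ a 1⟩) (fun l => (F l).2) hζ
  have words_mem {k m : ι} (hkm : k ≠ m) {ζ G : ListSeries B A} (hζ : ∀ l, ζ l ∈ centred E (𝒜 k))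
      (hG : ∀ l, G l ∈ words E 𝒜 m) : ∀ l, (ζ * G) l ∈ words E 𝒜 k :=
    ListSeries.mul_mem (fun a ha b hb => mul_mem_words hkm ha hb) hζ hG
  have expect_words {k : ι} {G : ListSeries B A} (hG : ∀ l, G l ∈ words E 𝒜 k) :
      expect E G = 0 := funext fun l => map_words hfree (hG l)
  set L := incl B lam
  set M := incl B mu
  have hLM : (1 - L) * M = 1 := by rw [← map_one (incl B), ← map_sub, ← map_mul, hlm]
  have hML : M * (1 - L) = 1 := by rw [← map_one (incl B), ← map_sub, ← map_mul, hml]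
  have hM1 : 1 + L * M = M := by
    linear_combination (norm := noncomm_ring) -hLM
  -- `θ` is `(1 - λ) λ ξ (1 - λ) η`, a sum of products of two letters
  set θ := incl B ((1 - lam) * lam) * ξ * (incl B (1 - lam) * η) with hθ
  have hθ0 : θ [] = 0 := by
    rw [hθ, mul_assoc]
    exact incl_mul_nil (by rw [ListSeries.mul_nil, h0, mul_zero]) _
  obtain ⟨u, hu⟩ := ListSeries.isUnit_one_sub hθ0
  have hR : (1 - θ) * (↑u⁻¹ : ListSeries B A) = 1 := by rw [← hu, Units.mul_inv]
  set R : ListSeries B A := ↑u⁻¹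
  have e₁ : Z₁ = M + L * ξ := by rw [eq_one_add hZ₁, hX, mul_add, ← add_assoc, hM1]
  have e₂ : Z₂ = M + L * η := by rw [eq_one_add hZ₂, hY, mul_add, ← add_assoc, hM1]
  have hZ₁' : Z₁ * (1 - L * x) = 1 := by
    obtain ⟨v, hv⟩ := ListSeries.isUnit_one_sub (incl_mul_nil h0 x)
    rw [← hv] at hZ₁ ⊢
    rw [Units.eq_inv_of_mul_eq_one_left hZ₁, Units.inv_mul]
  have hθ' : θ = (1 - L) * L * ξ * ((1 - L) * η) := by
    rw [hθ, map_mul, map_sub, map_one]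
  have key : Z₁ * (1 - L * x * y) * Z₂ = M * (1 - θ) := by
    have h₁ : Z₁ * L * x = L * (M + ξ) := by
      rw [← hX, eq_sub_of_add_eq' (eq_one_add hZ₁).symm, eq_sub_iff_add_eq,
        ← eq_sub_iff_add_eq', ← hZ₁', mul_sub, mul_one, mul_assoc]
    calc Z₁ * (1 - L * x * y) * Z₂ = Z₁ * Z₂ - Z₁ * L * x * (y * Z₂) := by noncomm_ring
      _ = (M + L * ξ) * (M + L * η) - L * (M + ξ) * (M + η) := by rw [h₁, hY, e₁, e₂]
      _ = M * (1 - θ) := by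
        rw [hθ']
        linear_combination (norm := noncomm_ring) hLM * M + (hLM - hML) * η +
          hML * (L * ξ * ((1 - L) * η))
  set W := R * ((1 - L) * Z₁) with hW
  have hWθ : (1 - θ) * W = 1 + (1 - L) * L * ξ := by
    rw [hW, ← mul_assoc, hR, one_mul, e₁, mul_add, hLM, ← mul_assoc]
  have hWmem : ∀ l, (W - 1) l ∈ words E 𝒜 i := by
    have hξ' : ∀ l, ((1 - L) * L * ξ) l ∈ centred E (𝒜 i) := by
      have := left_mem i ((1 - lam) * lam) hξ
      rwa [map_mul, map_sub, map_one] at this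
    have hη' := left_mem j (1 - lam) hη
    have hξ'' := left_mem i ((1 - lam) * lam) hξ
    refine ListSeries.mem_of_eq_add_mul hθ0 (Z₀ := (1 - L) * L * ξ + θ) ?_ (fun l => ?_) ?_
    · linear_combination (norm := noncomm_ring) hWθ
    · exact add_mem (centred_le_words E 𝒜 i (hξ' l))
        (words_mem hij hξ'' (fun l => centred_le_words E 𝒜 j (hη' l)) l)
    · intro G hG
      rw [hθ, mul_assoc]
      exact words_mem hij hξ'' (words_mem hij.symm hη' hG)
  refine ⟨Z₂ * W, ?_, ?_⟩
  · have h : Z₁ * ((1 - L * x * y) * (Z₂ * W)) = Z₁ := by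
      calc Z₁ * ((1 - L * x * y) * (Z₂ * W)) = Z₁ * (1 - L * x * y) * Z₂ * W := by
            simp only [mul_assoc]
        _ = M * ((1 - θ) * R) * ((1 - L) * Z₁) := by rw [key, hW]; simp only [mul_assoc]
        _ = Z₁ := by rw [hR, mul_one, ← mul_assoc, hML, one_mul]
    calc (1 - L * x * y) * (Z₂ * W) = (1 - L * x) * (Z₁ * ((1 - L * x * y) * (Z₂ * W))) := by
          rw [← mul_assoc (1 - L * x), hZ₁, one_mul]
      _ = 1 := by rw [h, hZ₁]
  · have hsplit : Z₂ * W = M + L * η + M * (W - 1) + L * η * (W - 1) := by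
      rw [e₂]
      noncomm_ring
    rw [hsplit, map_add, map_add, map_add, expect_incl hE, expect_incl_mul hE mu,
      expect_words hWmem, expect_words (words_mem hij.symm (left_mem j lam hη) hWmem),
      expect_words fun l => centred_le_words E 𝒜 j (left_mem j lam hη l), mul_zero, add_zero,
      add_zero, add_zero]

end Expect

end OpValued

/-! ### Moment series and the `S`-transform -/

namespace OpValued

variable {A : Type*} [Ring A] [Algebra ℂ A] {B : Subalgebra ℂ A} {E : A →ₗ[ℂ] B}

theorem subst_incl (G F : ListSeries B B) :
    ListSeries.subst G (incl B F) = incl B (ListSeries.subst G F) :=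
  (ListSeries.map_subst B.val.toRingHom.toAddMonoidHom G F).symm

theorem expect_subst (G : ListSeries B B) (F : ListSeries B A) :
    expect E (ListSeries.subst G F) = ListSeries.subst G (expect E F) :=
  ListSeries.map_subst E.toAddMonoidHom G F

theorem toList_momentSeries_nil (x : A) : (momentSeries E x).toList [] = E x := by
  have h := momentSeries_apply E x 0 ([] : List B).get
  rwa [List.ofFn_zero, List.prod_nil, mul_one] at h

/-- The series `(1 - I x)⁻¹`, whose terms are `(b_1, …, b_n) ↦ b_1 x ⋯ b_n x`, has expectation
`1 + I Φ_x`. -/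
theorem exists_resolvent_I (hE : IsCondExp E) (x : A) :
    ∃ Z : ListSeries B A, (1 - incl B MulSeries.I.toList * ListSeries.const x) * Z = 1 ∧
      expect E Z = 1 + (MulSeries.I * momentSeries E x).toList := by
  let Z : ListSeries B A := fun l => (l.map fun b : B => (b : A) * x).prod
  refine ⟨Z, ?_, ?_⟩
  · have hI : incl B MulSeries.I.toList = ListSeries.linear fun b : B => (b : A) := by
      rw [MulSeries.toList_I]
      exact ListSeries.mapHom_linear _ _
    rw [sub_mul, one_mul, sub_eq_iff_eq_add, hI, mul_assoc]
    ext l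
    rw [ListSeries.add_apply]
    cases l with
    | nil =>
      rw [ListSeries.mul_nil, ListSeries.linear_nil, zero_mul, add_zero, ListSeries.one_nil]
      rfl
    | cons b l =>
      rw [ListSeries.linear_mul_cons, ListSeries.const_mul_apply, ListSeries.one_cons, zero_add,
        ← mul_assoc]
      exact List.prod_cons
  · ext1 l
    rw [expect_apply, ListSeries.add_apply, MulSeries.toList_mul, MulSeries.toList_I]
    cases l with
    | nil =>
      rw [ListSeries.mul_nil, ListSeries.linear_nil, zero_mul, add_zero, ListSeries.one_nil]
      exact hE.map_coe 1
    | cons b l =>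
      rw [ListSeries.linear_mul_cons, ListSeries.one_cons, zero_add, MulSeries.toList,
        momentSeries_apply]
      have h : (List.ofFn fun i => ((l.get i : B) : A) * x) = l.map fun b : B => (b : A) * x := by
        conv_rhs => rw [← List.ofFn_get l, List.map_ofFn]
        rfl
      rw [h]
      have := hE.map_bimodule b (x * (l.map fun b : B => (b : A) * x).prod) 1
      simpa [Z, mul_assoc] using this

/-- The series `(1 - χ x)⁻¹` has expectation `1 + (I Φ_x) ∘ χ`: composition with `χ` is a ring
homomorphism that commutes with the expectation and maps `I` to `χ`. -/
theorem expect_resolvent (hE : IsCondExp E) {x : A} {χ : ListSeries B B} (hχ : χ [] = 0)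
    {Z : ListSeries B A} (hZ : (1 - incl B χ * ListSeries.const x) * Z = 1) :
    expect E Z = 1 + ListSeries.subst χ (MulSeries.I * momentSeries E x).toList := by
  obtain ⟨Y, hY, hEY⟩ := exists_resolvent_I hE x
  have h := congrArg (ListSeries.substHom χ) hY
  rw [map_mul, map_sub, map_mul, map_one, ListSeries.substHom_apply, ListSeries.substHom_apply,
    ListSeries.substHom_apply, ListSeries.subst_const, subst_incl, MulSeries.toList_I,
    ListSeries.subst_linear hχ] at h
  have hZY : Z = ListSeries.subst χ Y :=
    (ListSeries.isUnit_one_sub (incl_mul_nil hχ _)).mul_left_cancel (hZ.trans h.symm)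
  rw [hZY, expect_subst, hEY, ← ListSeries.substHom_apply, map_add, map_one,
    ListSeries.substHom_apply]

theorem exists_resolvent {x : A} {χ : ListSeries B B} (hχ : χ [] = 0) :
    ∃ Z : ListSeries B A, (1 - incl B χ * ListSeries.const x) * Z = 1 := by
  exact (ListSeries.isUnit_one_sub (incl_mul_nil hχ _)).exists_right_inv

theorem I_mul_cancel {F G : ListSeries B B}
    (h : MulSeries.I.toList * F = MulSeries.I.toList * G) : F = G := by
  ext1 l
  have := congrFun h (1 :: l)
  rwa [MulSeries.toList_I, ListSeries.linear_mul_cons, ListSeries.linear_mul_cons, one_mul,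
    one_mul] at this

theorem toList_nil_eq_zero_iff (χ : MulSeries B) : χ.toList [] = 0 ↔ χ 0 = 0 := by
  refine ⟨fun h => MultilinearMap.ext fun b => ?_, fun h => ?_⟩
  · rw [← MulSeries.toList_ofFn, List.ofFn_zero, h, zero_apply]
  · change χ 0 _ = 0
    rw [h]
    rfl

theorem subst_I_mul {χ : ListSeries B B} (hχ : χ [] = 0) (F : ListSeries B B) :
    ListSeries.subst χ (MulSeries.I.toList * F) = χ * ListSeries.subst χ F := by
  rw [ListSeries.subst_mul, MulSeries.toList_I, ListSeries.subst_linear hχ]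

theorem I_mul_nil (F : ListSeries B B) : (MulSeries.I.toList * F : ListSeries B B) [] = 0 := by
  rw [ListSeries.mul_nil, MulSeries.toList_I, ListSeries.linear_nil, zero_mul]

/-- The `S`-transform in terms of the series `σ` with `χ = I σ`: the equation `(I Φ_x) ∘ χ = I`
becomes `σ (Φ_x ∘ (I σ)) = 1`, and `S = (1 + I) σ`. -/
theorem isSTransform_iff {x : A} (hx : IsUnit (E x)) (S : MulSeries B) :
    IsSTransform E x S ↔ ∃ σ : MulSeries B,
      σ.toList * ListSeries.subst (MulSeries.I * σ).toList (momentSeries E x).toList = 1 ∧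
      S.toList = (1 + MulSeries.I.toList) * σ.toList := by
  constructor
  · rintro ⟨χ, h0, h1, h2⟩
    rw [← toList_nil_eq_zero_iff] at h0
    replace h1 := congrArg MulSeries.toList h1
    replace h2 := congrArg MulSeries.toList h2
    rw [MulSeries.toList_comp, MulSeries.toList_mul, subst_I_mul h0] at h1
    rw [MulSeries.toList_mul, MulSeries.toList_add, MulSeries.toList_one,
      MulSeries.toList_mul] at h2
    obtain ⟨σ, hσ, hσ'⟩ := MulSeries.exists_mul_eq_one ((momentSeries E x).comp χ) (by
      rw [MulSeries.toList_comp, ListSeries.subst_nil, toList_momentSeries_nil]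
      exact hx)
    rw [MulSeries.toList_comp] at hσ hσ'
    have hχ : χ.toList = MulSeries.I.toList * σ.toList := by
      rw [← h1, mul_assoc, hσ, mul_one]
    refine ⟨σ, ?_, I_mul_cancel ?_⟩
    · rw [MulSeries.toList_mul, ← hχ, hσ']
    · rw [← h2, hχ]
      noncomm_ring
  · rintro ⟨σ, h1, h2⟩
    refine ⟨MulSeries.I * σ, ?_, MulSeries.toList_injective ?_, MulSeries.toList_injective ?_⟩
    · rw [← toList_nil_eq_zero_iff, MulSeries.toList_mul, I_mul_nil]
    · rw [MulSeries.toList_comp, MulSeries.toList_mul MulSeries.I (momentSeries E x), subst_I_mul,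
        MulSeries.toList_mul, mul_assoc, ← MulSeries.toList_mul, h1, mul_one]
      rw [MulSeries.toList_mul, I_mul_nil]
    · rw [MulSeries.toList_mul, MulSeries.toList_mul, MulSeries.toList_mul, MulSeries.toList_add,
        MulSeries.toList_one, h2]
      noncomm_ring

/-- The equation `σ (Φ ∘ (I σ)) = 1` determines the terms of `σ` one after the other. -/
theorem existsUnique_mul_subst_eq_one (Φ : MulSeries B) (hΦ : IsUnit (Φ.toList [])) :
    ∃! σ : MulSeries B, σ.toList * ListSeries.subst (MulSeries.I * σ).toList Φ.toList = 1 := by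
  obtain ⟨e, he⟩ := hΦ
  -- `σ U = 1` rewritten as `σ = (1 - σ (U - U_0)) U_0⁻¹`, where `U = Φ ∘ (I σ)` and `U_0 = Φ_0 = e`
  let T : MulSeries B → MulSeries B := fun σ =>
    (1 - σ * (Φ - MulSeries.const (e : B)).comp (MulSeries.I * σ)) * MulSeries.const (↑e⁻¹ : B)
  have hT : ∀ σ : MulSeries B, T σ = σ ↔
      σ.toList * ListSeries.subst (MulSeries.I * σ).toList Φ.toList = 1 := by
    intro σ
    have hc : ListSeries.const (β := B) (↑e⁻¹ : B) * ListSeries.const (e : B) = 1 := by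
      rw [ListSeries.const_mul_const, Units.inv_mul, ListSeries.const_one]
    have hc' : ListSeries.const (β := B) (e : B) * ListSeries.const (↑e⁻¹ : B) = 1 := by
      rw [ListSeries.const_mul_const, Units.mul_inv, ListSeries.const_one]
    rw [← MulSeries.toList_injective.eq_iff]
    simp only [T, MulSeries.toList_mul _ (MulSeries.const _), MulSeries.toList_sub,
      MulSeries.toList_one, MulSeries.toList_mul σ, MulSeries.toList_comp, MulSeries.toList_const]
    rw [← ListSeries.substHom_apply, map_sub, ListSeries.substHom_apply, ListSeries.substHom_apply,
      ListSeries.subst_const]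
    generalize ListSeries.subst (MulSeries.I * σ).toList Φ.toList = U
    constructor
    · intro h
      linear_combination (norm := noncomm_ring) (-h) * ListSeries.const (e : B) +
        (1 - σ.toList * (U - ListSeries.const (e : B))) * hc
    · intro h
      linear_combination (norm := noncomm_ring) (-h) * ListSeries.const (↑e⁻¹ : B) +
        σ.toList * hc'
  have hfix := MulSeries.existsUnique_fixedPoint T (by
    intro n F G h
    have hIF : ∀ k ≤ n, (MulSeries.I * F : MulSeries B) k = (MulSeries.I * G : MulSeries B) k :=
      fun k hk => MulSeries.I_mul_congr fun m hm => h m (by omega)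
    have h0 (K : MulSeries B) (b : Fin 0 → B) :
        (Φ - MulSeries.const (e : B)).comp K 0 b = 0 := by
      rw [← MulSeries.toList_ofFn, List.ofFn_zero, MulSeries.toList_comp, ListSeries.subst_nil,
        MulSeries.toList_sub, MulSeries.toList_const, ListSeries.sub_apply, he,
        ListSeries.const_nil, sub_self]
    refine MulSeries.mul_congr fun k hk b b' => congrArg (· * _) ?_
    have : (F * (Φ - MulSeries.const (e : B)).comp (MulSeries.I * F) : MulSeries B) k =
        (G * (Φ - MulSeries.const (e : B)).comp (MulSeries.I * G) : MulSeries B) k := by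
      refine MulSeries.mul_congr fun m hm c c' => ?_
      rcases hm.eq_or_lt with rfl | hm
      · generalize hd : m - m = d at c'
        obtain rfl : d = 0 := by omega
        rw [h0, h0, mul_zero, mul_zero]
      · rw [h m (by omega), MulSeries.comp_congr fun i hi => hIF i (by omega)]
    exact congrArg (fun K => ((1 : MulSeries B) k - K) b) this)
  simpa only [hT] using hfix

theorem existsUnique_isSTransform {x : A} (hx : IsUnit (E x)) : ∃! S, IsSTransform E x S := by
  obtain ⟨σ, hσ, huniq⟩ := existsUnique_mul_subst_eq_one (momentSeries E x)
    (by rwa [toList_momentSeries_nil])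
  refine ⟨(1 + MulSeries.I) * σ, (isSTransform_iff hx _).2 ⟨σ, hσ, ?_⟩, fun S hS => ?_⟩
  · rw [MulSeries.toList_mul, MulSeries.toList_add, MulSeries.toList_one]
  · obtain ⟨τ, hτ, hSτ⟩ := (isSTransform_iff hx _).1 hS
    apply MulSeries.toList_injective
    rw [hSτ, huniq τ hτ, MulSeries.toList_mul, MulSeries.toList_add, MulSeries.toList_one]

theorem IsSTransform.isUnit_nil {x : A} (hx : IsUnit (E x)) {S : MulSeries B}
    (hS : IsSTransform E x S) : IsUnit (S.toList []) := by
  obtain ⟨σ, hσ, hSσ⟩ := (isSTransform_iff hx _).1 hS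
  have h := congrFun hσ []
  rw [ListSeries.mul_nil, ListSeries.subst_nil, toList_momentSeries_nil, ListSeries.one_nil] at h
  rw [hSσ, ListSeries.mul_nil, ListSeries.add_apply, ListSeries.one_nil, MulSeries.toList_I,
    ListSeries.linear_nil, add_zero, one_mul]
  obtain ⟨e, he⟩ := hx
  rw [← he] at h
  exact ⟨e⁻¹, (Units.eq_inv_of_mul_eq_one_right h).symm⟩

/-! ### Products of free variables -/

theorem expect_mul_of_free (hE : IsCondExp E) {x y : A} (hfree : FreeVariables E x y) :
    E (x * y) = E x * E y := by
  have hsub (a : A) : E (a - (E a : A)) = 0 := by rw [map_sub, hE.map_coe, sub_self]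
  have hmem {a : A} : a - (E a : A) ∈ Algebra.adjoin ℂ ((B : Set A) ∪ {a}) :=
    sub_mem (Algebra.subset_adjoin (Or.inr rfl)) (Algebra.subset_adjoin (Or.inl (E a).2))
  have h := hfree.2 1 ![0, 1] ![x - (E x : A), y - (E y : A)]
    (by intro j; fin_cases j; exacts [hmem, hmem])
    (by intro j; fin_cases j; exacts [hsub x, hsub y])
    (by intro j; fin_cases j; simp)
  have h₁ := hE.map_bimodule 1 x (E y)
  have h₂ := hE.map_bimodule (E x) y 1
  have h₃ := hE.map_coe (E x * E y)
  simp only [OneMemClass.coe_one, one_mul, mul_one, MulMemClass.coe_mul] at h₁ h₂ h₃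
  simp only [List.ofFn_succ, Matrix.cons_val_zero, Matrix.cons_val_succ, List.ofFn_zero,
    List.prod_cons, List.prod_nil, mul_one, sub_mul, mul_sub, map_sub, h₁, h₂, h₃] at h
  rw [sub_self, sub_zero, sub_eq_zero] at h
  exact h

/-- Dykema's formula: the right-hand side satisfies the defining property of the `S`-transform of
`x y`, with `χ_{xy} = S_y · χ_x ∘ w` for `w = S_y⁻¹ I S_y`. -/
theorem IsSTransform.mul (hE : IsCondExp E) {x y : A} (hfree : FreeVariables E x y)
    {Sx Sy T : MulSeries B} (hSx : IsSTransform E x Sx) (hSy : IsSTransform E y Sy)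
    (hTS : T.toList * Sy.toList = 1) (hST : Sy.toList * T.toList = 1) :
    IsSTransform E (x * y) (Sy * Sx.comp (T * MulSeries.I * Sy)) := by
  obtain ⟨χx, hx0, hx1, hx2⟩ := hSx
  obtain ⟨χy, hy0, hy1, hy2⟩ := hSy
  rw [← toList_nil_eq_zero_iff] at hx0 hy0
  obtain ⟨Zx, hZx⟩ := exists_resolvent (x := x) hx0
  obtain ⟨Zy, hZy⟩ := exists_resolvent (x := y) hy0
  have hEx := expect_resolvent hE hx0 hZx
  have hEy := expect_resolvent hE hy0 hZy
  rw [← MulSeries.toList_comp, hx1] at hEx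
  rw [← MulSeries.toList_comp, hy1] at hEy
  replace hx2 := congrArg MulSeries.toList hx2
  replace hy2 := congrArg MulSeries.toList hy2
  simp only [MulSeries.toList_mul, MulSeries.toList_add, MulSeries.toList_one] at hx2 hy2
  set S := Sy.toList
  set w := (T * MulSeries.I * Sy).toList with hw
  have hw' : w = T.toList * MulSeries.I.toList * S := by
    rw [hw, MulSeries.toList_mul, MulSeries.toList_mul]
  have hw0 : w [] = 0 := by
    rw [hw', mul_assoc, ListSeries.mul_nil, I_mul_nil, mul_zero]
  have hIw : ListSeries.subst w MulSeries.I.toList = w := by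
    rw [MulSeries.toList_I, ListSeries.subst_linear hw0]
  have hSw : S * w = MulSeries.I.toList * S := by
    rw [hw', ← mul_assoc, ← mul_assoc, hST, one_mul]
  set a := ListSeries.subst w χx.toList with ha
  set s := ListSeries.subst w Sx.toList with hs
  have has : (1 + w) * a = w * s := by
    have h := congrArg (ListSeries.substHom w) hx2
    rwa [map_mul, map_mul, map_add, map_one, ListSeries.substHom_apply, ListSeries.substHom_apply,
      ListSeries.substHom_apply, hIw] at h
  have ha0 : a [] = 0 := hx0
  obtain ⟨v, hv⟩ : IsUnit (1 + w) := by
    have := ListSeries.isUnit_one_sub (F := -w) (by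
      change -w [] = 0
      rw [hw0, neg_zero])
    rwa [sub_neg_eq_add] at this
  have hv₁ : (↑v⁻¹ : ListSeries B B) * (1 + w) = 1 := by rw [← hv, Units.inv_mul]
  have hv₂ : (1 + w) * (↑v⁻¹ : ListSeries B B) = 1 := by rw [← hv, Units.mul_inv]
  set V : ListSeries B B := ↑v⁻¹
  have hχy : V * w = T.toList * χy.toList := by
    have h : (1 + w) * (T.toList * χy.toList) = w := by
      have h' : S * (1 + w) = (1 + MulSeries.I.toList) * S := by
        rw [mul_add, hSw, add_mul, mul_one, one_mul]
      calc (1 + w) * (T.toList * χy.toList)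
          = T.toList * (S * (1 + w)) * (T.toList * χy.toList) := by
            rw [← mul_assoc T.toList S, hTS, one_mul]
        _ = T.toList * ((1 + MulSeries.I.toList) * χy.toList) := by
            rw [h']
            simp only [mul_assoc]
            rw [← mul_assoc S, hST, one_mul]
        _ = w := by rw [hy2, hw', mul_assoc]
    calc V * w = V * ((1 + w) * (T.toList * χy.toList)) := by rw [h]
      _ = T.toList * χy.toList := by rw [← mul_assoc, hv₁, one_mul]
  have hVs : V * w * s = a := by rw [mul_assoc, ← has, ← mul_assoc, hv₁, one_mul]
  have hlm : (1 - V * w) * (1 + w) = 1 := by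
    linear_combination (norm := noncomm_ring) -hv₁ * w
  have hml : (1 + w) * (1 - V * w) = 1 := by
    linear_combination (norm := noncomm_ring) -hv₂ * w
  have hcancel (F G : ListSeries B B) (h : V * w * F = V * w * G) : F = G := by
    have h₁ : w * F = w * G := by
      have := congrArg ((1 + w) * ·) h
      simpa only [← mul_assoc, hv₂, one_mul] using this
    have h₂ : S * F = S * G := I_mul_cancel <| by
      rw [← mul_assoc, ← mul_assoc, ← hSw, mul_assoc, mul_assoc, h₁]
    have := congrArg (T.toList * ·) h₂
    simpa only [← mul_assoc, hTS, one_mul] using this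
  have hTS' : incl B T.toList * incl B S = 1 := by rw [← map_mul, hTS, map_one]
  have hST' : incl B S * incl B T.toList = 1 := by rw [← map_mul, hST, map_one]
  have hconst (𝒜 : Subalgebra ℂ A) {z : A} (hz : z ∈ 𝒜) (l : List B) :
      (ListSeries.const z : ListSeries B A) l ∈ 𝒜 := by
    cases l with
    | nil => exact hz
    | cons b l => exact 𝒜.zero_mem
  have hx : ∀ l, (incl B s * ListSeries.const x : ListSeries B A) l ∈
      Algebra.adjoin ℂ ((B : Set A) ∪ {x}) :=
    mul_mem_subalgebra _ (fun l => hfree.1 0 (s l).2)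
      (hconst _ (Algebra.subset_adjoin (Or.inr rfl)))
  have hy : ∀ l, (ListSeries.const y * incl B S : ListSeries B A) l ∈
      Algebra.adjoin ℂ ((B : Set A) ∪ {y}) :=
    mul_mem_subalgebra _ (hconst _ (Algebra.subset_adjoin (Or.inr rfl)))
      (fun l => hfree.1 1 (S l).2)
  have hZ₁ :
      (1 - incl B (V * w) * (incl B s * ListSeries.const x)) * ListSeries.subst w Zx = 1 := by
    have h := congrArg (ListSeries.substHom w) hZx
    rw [map_mul, map_sub, map_mul, map_one, ListSeries.substHom_apply, ListSeries.substHom_apply,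
      ListSeries.substHom_apply, ListSeries.subst_const, subst_incl] at h
    rw [← mul_assoc, ← map_mul, hVs, h]
  have hE₁ : expect E (ListSeries.subst w Zx) = 1 + w := by
    rw [expect_subst, hEx, ← ListSeries.substHom_apply, map_add, map_one, ListSeries.substHom_apply,
      hIw]
  have hZ₂ : (1 - incl B (V * w) * (ListSeries.const y * incl B S)) *
      (incl B T.toList * Zy * incl B S) = 1 := by
    rw [hχy, map_mul]
    calc _ = incl B T.toList * Zy * incl B S - incl B T.toList * incl B χy.toList *
            ListSeries.const y * (incl B S * incl B T.toList) * Zy * incl B S := by noncomm_ring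
      _ = incl B T.toList * ((1 - incl B χy.toList * ListSeries.const y) * Zy) * incl B S := by
        rw [hST']
        noncomm_ring
      _ = 1 := by rw [hZy, mul_one, hTS']
  have hE₂ : expect E (incl B T.toList * Zy * incl B S) = 1 + w := by
    rw [expect_mul_incl hE, expect_incl_mul hE, hEy, mul_add, mul_one, add_mul, hTS, hw']
  obtain ⟨Q, hQ, hEQ⟩ := exists_resolvent_mul hE hfree (i := 0) (j := 1) (by simp) hx hy
    (by rw [ListSeries.mul_nil, hw0, mul_zero]) hlm hml hcancel hZ₁ hE₁ hZ₂ hE₂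
  have hSa0 : (S * a) [] = 0 := by rw [ListSeries.mul_nil, ha0, mul_zero]
  have hQ' : (1 - incl B (S * a) * ListSeries.const (x * y)) *
      (incl B S * Q * incl B T.toList) = 1 := by
    rw [← mul_assoc (incl B (V * w)), ← map_mul, hVs] at hQ
    rw [map_mul, ← ListSeries.const_mul_const]
    calc _ = incl B S *
          ((1 - incl B a * ListSeries.const x * (ListSeries.const y * incl B S)) * Q) *
          incl B T.toList := by noncomm_ring
      _ = 1 := by rw [hQ, mul_one, hST']
  have hfinal := expect_resolvent hE hSa0 hQ'
  rw [expect_mul_incl hE, expect_incl_mul hE, hEQ, mul_add, hSw, mul_one, add_mul, hST, mul_assoc,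
    hST, mul_one, add_right_inj] at hfinal
  refine ⟨Sy * χx.comp (T * MulSeries.I * Sy), ?_, MulSeries.toList_injective ?_,
    MulSeries.toList_injective ?_⟩
  · rw [← toList_nil_eq_zero_iff, MulSeries.toList_mul, MulSeries.toList_comp]
    exact hSa0
  · rw [MulSeries.toList_comp, MulSeries.toList_mul Sy, MulSeries.toList_comp]
    exact hfinal.symm
  · simp only [MulSeries.toList_mul _ (_ * _), MulSeries.toList_mul _ (MulSeries.comp _ _),
      MulSeries.toList_add, MulSeries.toList_one, MulSeries.toList_comp]
    calc (1 + MulSeries.I.toList) * (S * a) = (S + MulSeries.I.toList * S) * a := by noncomm_ring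
      _ = S * ((1 + w) * a) := by rw [← hSw]; noncomm_ring
      _ = MulSeries.I.toList * (S * s) := by rw [has, ← mul_assoc, hSw, mul_assoc]

end OpValued

theorem mainTheorem1 {A : Type*} [Ring A] [Algebra ℂ A] (B : Subalgebra ℂ A)
    (E : A →ₗ[ℂ] B) (hE : OpValued.IsCondExp E) (x y : A)
    (hfree : OpValued.FreeVariables E x y)
    (hx : IsUnit (E x)) (hy : IsUnit (E y)) :
    E (x * y) = E x * E y ∧ IsUnit (E (x * y)) ∧
    (∃! S, OpValued.IsSTransform E x S) ∧
    (∃! S, OpValued.IsSTransform E y S) ∧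
    (∃! S, OpValued.IsSTransform E (x * y) S) ∧
    ∀ Sx Sy Sxy : MulSeries B,
      OpValued.IsSTransform E x Sx → OpValued.IsSTransform E y Sy →
      OpValued.IsSTransform E (x * y) Sxy →
      ∃ T : MulSeries B, T * Sy = 1 ∧ Sy * T = 1 ∧
        Sxy = Sy * Sx.comp (T * MulSeries.I * Sy) := by
  have hmul := OpValued.expect_mul_of_free hE hfree
  have hxy : IsUnit (E (x * y)) := hmul ▸ hx.mul hy
  have huniq := OpValued.existsUnique_isSTransform hxy
  refine ⟨hmul, hxy, OpValued.existsUnique_isSTransform hx, OpValued.existsUnique_isSTransform hy,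
    huniq, fun Sx Sy Sxy hSx hSy hSxy => ?_⟩
  obtain ⟨T, hST, hTS⟩ := Sy.exists_mul_eq_one (hSy.isUnit_nil hy)
  refine ⟨T, MulSeries.toList_injective ?_, MulSeries.toList_injective ?_,
    huniq.unique hSxy (hSx.mul hE hfree hSy hTS hST)⟩
  · rw [MulSeries.toList_mul, hTS, MulSeries.toList_one]
  · rw [MulSeries.toList_mul, hST, MulSeries.toList_one]
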